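/- Theorem 3.1. All links are tame links in Euclidean 3-space, considered up to ambient isotopy. A regular diagram is a projection of a link to the plane that is an immersion whose only multiple points are finitely many transverse double points (the crossings), together with over/under information at each crossing; its arcs are the pieces into which the link is cut by removing the under points of all crossings. A $\mathbb{Z}$-coloring on a regular diagram $D$ is a map $\gamma:\{\text{arcs of }D\}\to\mathbb{Z}$ such that $2\gamma(a)=\gamma(b)+\gamma(c)$ at each crossing with over arc $a$ and under arcs $b$ and $c$; it is non-trivial if it does not assign the same color to all arcs. A link is $\mathbb{Z}$-colorable if it has a regular diagram admitting a non-trivial $\mathbb{Z}$-coloring, and for a $\mathbb{Z}$-colorable link $L$, $\mathrm{mincol}_{\mathbb{Z}}(L)$ denotes the minimum of the cardinalities of the images of all non-trivial $\mathbb{Z}$-colorings on all regular diagrams of $L$. A link is splittable if some embedded 2-sphere in its complement has points of the link on both sides. Let $L$ be a non-splittable $\mathbb{Z}$-colorable link. Then $\mathrm{mincol}_{\mathbb{Z}}(L)\ge 4$. -/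

import Mathlib

open Set Filter Topology Metric
open scoped ContDiff Manifold

/-- Euclidean 3-space. -/
abbrev Space : Type := EuclideanSpace ℝ (Fin 3)

/-- The plane of projection. -/
abbrev Plane : Type := EuclideanSpace ℝ (Fin 2)

/-- The projection along the third axis, `(x, y, z) ↦ (x, y)`. -/
def proj (p : Space) : Plane := !₂[p 0, p 1]

instance fact_finrank_space : Fact (Module.finrank ℝ Space = 2 + 1) :=
  ⟨by simp⟩

/-- A (tame) link in 3-space: finitely many pairwise disjoint smoothly embedded circles, each
given by a regular 1-periodic smooth parametrization which is injective modulo the period.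
Only the underlying set `Link.carrier` enters into the notion of equivalence of links below. -/
structure Link where
  /-- the number of components -/
  n : ℕ
  /-- the parametrizations of the components -/
  curve : Fin n → ℝ → Space
  smooth : ∀ i, ContDiff ℝ ∞ (curve i)
  periodic : ∀ i, Function.Periodic (curve i) 1
  immersed : ∀ i t, deriv (curve i) t ≠ 0
  embedded : ∀ i j s t, curve i s = curve j t → i = j ∧ ∃ k : ℤ, s - t = k

/-- `K` can be moved onto `K'` by a smooth ambient isotopy of 3-space: a smooth family
`H t`, `0 ≤ t ≤ 1`, of diffeomorphisms of 3-space with `H 0 = id` and `H 1 (K) = K'`. -/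
def AmbientIsotopic (K K' : Set Space) : Prop :=
  ∃ H : ℝ → Space → Space,
    ContDiffOn ℝ ∞ (fun p : ℝ × Space => H p.1 p.2) (Icc (0 : ℝ) 1 ×ˢ (univ : Set Space)) ∧
    (∀ t ∈ Icc (0 : ℝ) 1, ∃ G : Space → Space, ContDiff ℝ ∞ G ∧
      Function.LeftInverse G (H t) ∧ Function.RightInverse G (H t)) ∧
    (∀ x, H 0 x = x) ∧
    H 1 '' K = K'

/-- `S` is a smoothly embedded 2-sphere in 3-space (as the 2-sphere is compact, an injective
immersion is an embedding). -/
def IsEmbeddedSphere (S : Set Space) : Prop :=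
  ∃ e : sphere (0 : Space) 1 → Space,
    ContMDiff (𝓡 2) 𝓘(ℝ, Space) ∞ e ∧
    Function.Injective e ∧
    (∀ x, Function.Injective (mfderiv (𝓡 2) 𝓘(ℝ, Space) e x)) ∧
    range e = S

namespace Link

/-- The link as a subset of 3-space. -/
def carrier (L : Link) : Set Space := {p | ∃ i t, L.curve i t = p}

/-- Two links are equivalent if they are ambient isotopic. -/
def Equivalent (L L' : Link) : Prop := AmbientIsotopic L.carrier L'.carrier

/-- A link is splittable if some embedded 2-sphere in its complement separates it, i.e. the
link has points in different connected components of the complement of the sphere. -/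
def IsSplittable (L : Link) : Prop :=
  ∃ S : Set Space, IsEmbeddedSphere S ∧ Disjoint S L.carrier ∧
    ∃ p ∈ L.carrier, ∃ q ∈ L.carrier, q ∉ connectedComponentIn Sᶜ p

/-- The link is in regular position with respect to the projection `proj`: its projection is an
immersed curve, whose only multiple points are finitely many transverse double points. The regular
diagram of such a link is the projection, together with the information which of the two points
over a double point is the higher one. -/
structure IsRegular (L : Link) : Prop where
  immersed : ∀ i t, proj (deriv (L.curve i) t) ≠ 0
  double : ∀ p ∈ L.carrier, ∀ q ∈ L.carrier, ∀ r ∈ L.carrier,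
    proj p = proj q → proj q = proj r → p = q ∨ q = r ∨ p = r
  transverse : ∀ i j s t, L.curve i s ≠ L.curve j t →
    proj (L.curve i s) = proj (L.curve j t) →
    LinearIndependent ℝ ![proj (deriv (L.curve i) s), proj (deriv (L.curve j) t)]
  finite : {x : Plane | ∃ p ∈ L.carrier, ∃ q ∈ L.carrier,
    p ≠ q ∧ proj p = x ∧ proj q = x}.Finite

/-- `IsCrossing L p q`: `p` and `q` are the over point and the under point of a crossing
of the diagram of `L`. -/
def IsCrossing (L : Link) (p q : Space) : Prop :=
  p ∈ L.carrier ∧ q ∈ L.carrier ∧ proj p = proj q ∧ q 2 < p 2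

/-- The link with the under points of all crossings removed. -/
def cut (L : Link) : Set Space := {q ∈ L.carrier | ∀ p, ¬ L.IsCrossing p q}

/-- The arcs of the diagram of `L`: the connected components of the link cut at
the under points of all crossings. -/
def Arc (L : Link) : Type :=
  {A : Set Space // ∃ x ∈ L.cut, A = connectedComponentIn L.cut x}

/-- A `ℤ`-coloring of the diagram of `L`: a map `γ` from the arcs to `ℤ` with `2 γ(a) = γ(b) + γ(c)`
at each crossing with over arc `a`, where `b` and `c` are the two under arcs, which start from and
end in the under point `L.curve i t` of the crossing. -/
def IsZColoring (L : Link) (γ : L.Arc → ℤ) : Prop :=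
  ∀ (p : Space) (i : Fin L.n) (t : ℝ), L.IsCrossing p (L.curve i t) →
    ∀ a b c : L.Arc, p ∈ a.1 →
      (∀ᶠ ε in 𝓝[>] (0 : ℝ), L.curve i (t + ε) ∈ b.1) →
      (∀ᶠ ε in 𝓝[>] (0 : ℝ), L.curve i (t - ε) ∈ c.1) →
      2 * γ a = γ b + γ c

/-- `IsColoredDiagram L D γ`: `D` is in regular position and equivalent to `L`, so that the
diagram of `D` is a regular diagram of `L`, and `γ` is a non-trivial `ℤ`-coloring on it,
i.e. one that does not assign the same color to all arcs. -/
def IsColoredDiagram (L D : Link) (γ : D.Arc → ℤ) : Prop :=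
  L.Equivalent D ∧ D.IsRegular ∧ D.IsZColoring γ ∧ ∃ a b, γ a ≠ γ b

/-- A link is `ℤ`-colorable if it has a diagram admitting a non-trivial `ℤ`-coloring. -/
def IsZColorable (L : Link) : Prop :=
  ∃ (D : Link) (γ : D.Arc → ℤ), L.IsColoredDiagram D γ

/-- The minimal coloring number: the least cardinality of the image of a non-trivial `ℤ`-coloring
on a diagram of `L` (and `⊤` if the link is not `ℤ`-colorable). -/
noncomputable def mincolZ (L : Link) : ℕ∞ :=
  sInf {k : ℕ∞ | ∃ (D : Link) (γ : D.Arc → ℤ), L.IsColoredDiagram D γ ∧ (range γ).encard = k}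

end Link

/-! Suppose a non-trivial coloring of a diagram `D` of `L` uses two or three colors. One color `x`
(either of two, the median of three) is isolated: it never averages with a different color to a
color in use (`exists_isolated_color`). So at a crossing with one under arc of color `x`, the other
under arc and the over arc have color `x` too. Hence `x` persists along whole components
(`component_dichotomy`), and components of color `x` never pass under the others
(`exists_upper_sublink`). A compact sublink above the rest can be split off: a smooth graph fits
between the two (`exists_smooth_graph_between`). Once the graph is sheared flat, a large ball
resting on the plane contains the upper part and misses the lower (`exists_diffeo_separating`).
Pulling its boundary sphere back through the isotopy splits `L`. -/

/-! ### Arithmetic of the colors -/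

/-- A set of at most three integers, at least two, contains a number `x` whose average with any other
element of the set lies outside the set. -/
theorem exists_isolated_color {V : Set ℤ} (hV : V.encard < 4) (hV' : V.Nontrivial) :
    ∃ x ∈ V, (∃ y ∈ V, y ≠ x) ∧
      ∀ a ∈ V, ∀ b ∈ V, ∀ c ∈ V, 2 * a = b + c → b = x → a = x ∧ c = x := by
  have h2 : 2 ≤ V.encard := by
    have := Set.one_lt_encard_iff_nontrivial.2 hV'
    exact Order.add_one_le_of_lt this
  have hf : V.Finite := Set.finite_of_encard_le_coe (k := 4) hV.le
  obtain ⟨n, hn⟩ : ∃ n : ℕ, V.encard = n := ⟨V.ncard, hf.cast_ncard_eq.symm⟩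
  rw [hn] at hV h2
  have h3 : n < 4 := by exact_mod_cast hV
  have h4 : 2 ≤ n := by exact_mod_cast h2
  obtain rfl | rfl : n = 2 ∨ n = 3 := by omega
  · obtain ⟨x, y, hxy, rfl⟩ := Set.encard_eq_two.1 hn
    refine ⟨x, by simp, ⟨y, by simp, hxy.symm⟩, ?_⟩
    simp only [mem_insert_iff, mem_singleton_iff]
    omega
  · obtain ⟨x, y, z, hxy, hxz, hyz, rfl⟩ := Set.encard_eq_three.1 hn
    simp only [mem_insert_iff, mem_singleton_iff]
    -- The median works: its average with another color lies strictly between the two, where no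
    -- color remains. The extremes may fail, since they can average to the median.
    by_cases h1 : (x < y ∧ y < z) ∨ (z < y ∧ y < x)
    · exact ⟨y, by simp, ⟨x, by simp, hxy⟩, by omega⟩
    by_cases h2 : (y < x ∧ x < z) ∨ (z < x ∧ x < y)
    · exact ⟨x, by simp, ⟨y, by simp, hxy.symm⟩, by omega⟩
    · exact ⟨z, by simp, ⟨y, by simp, hyz⟩, by omega⟩

/-! ### Embedded spheres and splittability -/

/-- A diffeomorphism of space maps the round unit sphere to an embedded sphere. -/
theorem isEmbeddedSphere_image {F G : Space → Space} (hF : ContDiff ℝ ∞ F) (hG : ContDiff ℝ ∞ G)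
    (hFG : Function.LeftInverse F G) : IsEmbeddedSphere (G '' sphere 0 1) := by
  refine ⟨fun x => G x, ?_, ?_, ?_, ?_⟩
  · exact hG.contMDiff.comp (contMDiff_coe_sphere (n := 2) (E := Space))
  · exact hFG.injective.comp Subtype.val_injective
  · intro x
    have hGd : MDifferentiableAt 𝓘(ℝ, Space) 𝓘(ℝ, Space) G x :=
      (hG.differentiable (by simp)).differentiableAt.mdifferentiableAt
    have hcoe : MDifferentiableAt (𝓡 2) 𝓘(ℝ, Space) ((↑) : sphere (0 : Space) 1 → Space) x :=
      (contMDiff_coe_sphere (n := 2) (E := Space) (m := 1)).mdifferentiableAt (by simp)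
    have hcomp := mfderiv_comp x hGd hcoe
    have hinj : Function.Injective (fderiv ℝ G x) := by
      have h1 : (fderiv ℝ F (G x)).comp (fderiv ℝ G x) = ContinuousLinearMap.id ℝ Space := by
        rw [← fderiv_comp _ (hF.differentiable (by simp)).differentiableAt
          (hG.differentiable (by simp)).differentiableAt, hFG.comp_eq_id, fderiv_id]
      exact Function.LeftInverse.injective (g := fderiv ℝ F (G x)) fun v => DFunLike.congr_fun h1 v
    have : (fun x : sphere (0 : Space) 1 => G x) = G ∘ (↑) := rfl
    rw [this, hcomp, mfderiv_eq_fderiv]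
    exact hinj.comp (injective_mvfderiv_subtypeVal_sphere (n := 2) x)
  · rw [image_eq_range]

/-- A link is splittable if a diffeomorphism of space moves it off the unit sphere, with points
on both sides. -/
theorem Link.isSplittable_of_diffeo {L : Link} {F G : Space → Space} (hF : ContDiff ℝ ∞ F)
    (hG : ContDiff ℝ ∞ G) (hFG : Function.LeftInverse F G) (hGF : Function.LeftInverse G F)
    (hS : ∀ r ∈ L.carrier, ‖F r‖ ≠ 1) {p q : Space} (hp : p ∈ L.carrier) (hq : q ∈ L.carrier)
    (hFp : ‖F p‖ < 1) (hFq : 1 < ‖F q‖) : L.IsSplittable := by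
  refine ⟨G '' sphere 0 1, isEmbeddedSphere_image hF hG hFG, ?_, p, hp, q, hq, fun hmem => ?_⟩
  · rw [Set.disjoint_left]
    rintro _ ⟨x, hx, rfl⟩ h
    exact hS _ h (by rw [hFG x]; simpa using hx)
  have hpS : p ∈ (G '' sphere 0 1)ᶜ := by
    rintro ⟨x, hx, rfl⟩
    rw [hFG x] at hFp
    simp at hx
    linarith
  -- A connected set containing `p` and `q` carries a point with `‖F r‖ = 1`, which lies on the
  -- sphere.
  obtain ⟨r, hr, hr1⟩ := (isPreconnected_connectedComponentIn (F := (G '' sphere 0 1)ᶜ)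
    (x := p)).intermediate_value (mem_connectedComponentIn hpS) hmem
    (hF.continuous.norm.continuousOn) (show (1 : ℝ) ∈ Icc ‖F p‖ ‖F q‖ from ⟨hFp.le, hFq.le⟩)
  exact connectedComponentIn_subset _ _ hr ⟨F r, by simpa using hr1, hGF r⟩

/-! ### Separating stacked compact sets -/

theorem contDiff_proj : ContDiff ℝ ∞ proj := by
  unfold proj
  rw [contDiff_euclidean]
  intro i
  fin_cases i <;> simp <;> fun_prop

/-- If a compact set lies above another one, some smooth graph runs between them. -/
theorem exists_smooth_graph_between {K₁ K₂ : Set Space} (h₁ : IsCompact K₁) (h₂ : IsCompact K₂)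
    (h : ∀ p ∈ K₁, ∀ q ∈ K₂, proj p = proj q → q 2 < p 2) :
    ∃ f : Plane → ℝ, ContDiff ℝ ∞ f ∧ (∀ p ∈ K₁, f (proj p) < p 2) ∧
      ∀ q ∈ K₂, q 2 < f (proj q) := by
  have hπ : Continuous proj := contDiff_proj.continuous
  -- The admissible heights over `x`. They form a nonempty convex set, and an admissible height
  -- stays admissible nearby, so a partition of unity glues constant local choices.
  let T : Plane → Set ℝ := fun x =>
    {z | (∀ p ∈ K₁, proj p = x → z < p 2) ∧ ∀ q ∈ K₂, proj q = x → q 2 < z}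
  have hconv : ∀ x, Convex ℝ (T x) := by
    intro x
    have : T x = (⋂ p ∈ K₁, ⋂ _ : proj p = x, Iio (p 2)) ∩ ⋂ q ∈ K₂, ⋂ _ : proj q = x, Ioi (q 2) := by
      ext z; simp [T]
    rw [this]
    exact (convex_iInter₂ fun p _ => convex_iInter fun _ => convex_Iio _).inter
      (convex_iInter₂ fun p _ => convex_iInter fun _ => convex_Ioi _)
  have hgt : ∀ (x : Plane) (z : ℝ), (∀ p ∈ K₁, proj p = x → z < p 2) →
      ∀ᶠ y in 𝓝 x, ∀ p ∈ K₁, proj p = y → z < p 2 := by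
    intro x z hz
    -- The points of `K₁` violating the bound have compact, hence closed, shadow; it misses `x`, so
    -- it misses a neighborhood.
    have hc : IsCompact (proj '' (K₁ ∩ {p | p 2 ≤ z})) :=
      (h₁.inter_right (isClosed_le (by fun_prop) (by fun_prop))).image hπ
    have hx : x ∈ (proj '' (K₁ ∩ {p | p 2 ≤ z}))ᶜ := by
      rintro ⟨p, ⟨hp, hpz⟩, rfl⟩
      exact absurd (hz p hp rfl) (not_lt.2 hpz)
    filter_upwards [hc.isClosed.isOpen_compl.mem_nhds hx] with y hy p hp hpy
    by_contra hlt
    exact hy ⟨p, ⟨hp, not_lt.1 hlt⟩, hpy⟩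
  have hlt : ∀ (x : Plane) (z : ℝ), (∀ p ∈ K₂, proj p = x → p 2 < z) →
      ∀ᶠ y in 𝓝 x, ∀ p ∈ K₂, proj p = y → p 2 < z := by
    intro x z hz
    have hc : IsCompact (proj '' (K₂ ∩ {p | z ≤ p 2})) :=
      (h₂.inter_right (isClosed_le (by fun_prop) (by fun_prop))).image hπ
    have hx : x ∈ (proj '' (K₂ ∩ {p | z ≤ p 2}))ᶜ := by
      rintro ⟨p, ⟨hp, hpz⟩, rfl⟩
      exact absurd (hz p hp rfl) (not_lt.2 hpz)
    filter_upwards [hc.isClosed.isOpen_compl.mem_nhds hx] with y hy p hp hpy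
    by_contra hlt
    exact hy ⟨p, ⟨hp, not_lt.1 hlt⟩, hpy⟩
  have hne : ∀ x, (T x).Nonempty := by
    intro x
    have hfib : IsClosed {p : Space | proj p = x} := isClosed_eq hπ continuous_const
    have hz : Continuous fun p : Space => p 2 := by fun_prop
    have c₁ := (h₁.inter_right hfib).image hz
    have c₂ := (h₂.inter_right hfib).image hz
    suffices ∃ z, (∀ w ∈ (fun p : Space => p 2) '' (K₁ ∩ {p | proj p = x}), z < w) ∧
        ∀ w ∈ (fun p : Space => p 2) '' (K₂ ∩ {p | proj p = x}), w < z by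
      obtain ⟨z, hz₁, hz₂⟩ := this
      exact ⟨z, fun p hp hpx => hz₁ _ ⟨p, ⟨hp, hpx⟩, rfl⟩, fun p hp hpx => hz₂ _ ⟨p, ⟨hp, hpx⟩, rfl⟩⟩
    have hlt : ∀ w ∈ (fun p : Space => p 2) '' (K₁ ∩ {p | proj p = x}),
        ∀ v ∈ (fun p : Space => p 2) '' (K₂ ∩ {p | proj p = x}), v < w := by
      rintro _ ⟨p, ⟨hp, hpx⟩, rfl⟩ _ ⟨q, ⟨hq, hqx⟩, rfl⟩
      exact h p hp q hq (hpx.trans hqx.symm)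
    rcases Set.eq_empty_or_nonempty ((fun p : Space => p 2) '' (K₁ ∩ {p | proj p = x})) with e₁ | n₁
    · obtain ⟨b, hb⟩ := c₂.bddAbove
      exact ⟨b + 1, by simp [e₁], fun w hw => lt_add_of_le_of_pos (hb hw) one_pos⟩
    rcases Set.eq_empty_or_nonempty ((fun p : Space => p 2) '' (K₂ ∩ {p | proj p = x})) with e₂ | n₂
    · obtain ⟨b, hb⟩ := c₁.bddBelow
      exact ⟨b - 1, fun w hw => (sub_one_lt b).trans_le (hb hw), by simp [e₂]⟩
    obtain ⟨u, hu, hu'⟩ := c₁.exists_isLeast n₁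
    obtain ⟨v, hv, hv'⟩ := c₂.exists_isGreatest n₂
    obtain ⟨z, hvz, hzu⟩ := exists_between (hlt u hu v hv)
    exact ⟨z, fun w hw => hzu.trans_le (hu' hw), fun w hw => (hv' hw).trans_lt hvz⟩
  obtain ⟨f, hf⟩ := exists_contMDiffMap_forall_mem_convex_of_local_const (n := ⊤) 𝓘(ℝ, Plane) hconv
    (by
      intro x
      obtain ⟨z, hz₁, hz₂⟩ := hne x
      exact ⟨z, (hgt x z hz₁).and (hlt x z hz₂)⟩)
  exact ⟨f, f.contMDiff.contDiff, fun p hp => (hf _).1 p hp rfl, fun q hq => (hf _).2 q hq rfl⟩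

/-- The vertical unit vector. -/
noncomputable def vertical : Space := EuclideanSpace.single 2 1

theorem proj_add_smul_vertical (p : Space) (z : ℝ) : proj (p + z • vertical) = proj p := by
  ext i
  fin_cases i <;> simp [proj, vertical]

/-- For `z > 0` this turns membership in the ball of radius `z` about `z • vertical` into `‖p‖ ^ 2 <
2 * z * p 2`. -/
theorem norm_sub_smul_vertical_sq (p : Space) (z : ℝ) :
    ‖p - z • vertical‖ ^ 2 = ‖p‖ ^ 2 - 2 * z * p 2 + z ^ 2 := by
  simp only [EuclideanSpace.norm_sq_eq, Fin.sum_univ_three, vertical]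
  simp
  ring

/-- A compact set which lies above another one can be separated from it by a diffeomorphism
moving it into the open unit ball, and the other set out of the closed unit ball. -/
theorem exists_diffeo_separating {K₁ K₂ : Set Space} (h₁ : IsCompact K₁) (h₂ : IsCompact K₂)
    (h : ∀ p ∈ K₁, ∀ q ∈ K₂, proj p = proj q → q 2 < p 2) :
    ∃ F G : Space → Space, ContDiff ℝ ∞ F ∧ ContDiff ℝ ∞ G ∧ Function.LeftInverse F G ∧
      Function.LeftInverse G F ∧ (∀ p ∈ K₁, ‖F p‖ < 1) ∧ ∀ q ∈ K₂, 1 < ‖F q‖ := by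
  obtain ⟨f, hf, hf₁, hf₂⟩ := exists_smooth_graph_between h₁ h₂ h
  have hfp : ContDiff ℝ ∞ fun p => f (proj p) := hf.comp contDiff_proj
  let S : Space → Space := fun p => p - f (proj p) • vertical
  have hS : ContDiff ℝ ∞ S := contDiff_id.sub (hfp.smul contDiff_const)
  have hS2 : ∀ p, S p 2 = p 2 - f (proj p) := fun p => by simp [S, vertical]
  -- `S` flattens the graph to height zero. The balls of radius `R` about `R • vertical` exhaust the
  -- open upper half-space, so one of them contains the compact set `S '' K₁`.
  obtain ⟨R, hR, hR₁⟩ : ∃ R : ℝ, 0 < R ∧ ∀ p ∈ K₁, ‖S p‖ ^ 2 < 2 * R * S p 2 := by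
    have hcont : ContinuousOn (fun p => ‖S p‖ ^ 2 / S p 2) K₁ := by
      refine ContinuousOn.div (by have := hS.continuous; fun_prop)
        (by have := hS.continuous; fun_prop) fun p hp => ?_
      rw [hS2]
      exact (sub_pos.2 (hf₁ p hp)).ne'
    obtain ⟨b, hb⟩ := h₁.bddAbove_image hcont
    -- The `1` keeps `R` positive; the factor `2` makes the inequality strict.
    refine ⟨max b 1, by positivity, fun p hp => ?_⟩
    have hpos : 0 < S p 2 := by rw [hS2]; exact sub_pos.2 (hf₁ p hp)
    have := hb ⟨p, hp, rfl⟩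
    rw [div_le_iff₀ hpos] at this
    nlinarith [le_max_left b 1, le_max_right b 1]
  refine ⟨fun p => R⁻¹ • (S p - R • vertical),
    fun p => (R • p + R • vertical) + f (proj (R • p + R • vertical)) • vertical,
    (hS.sub contDiff_const).const_smul _, ?_, ?_, ?_, ?_, ?_⟩
  · have : ContDiff ℝ ∞ fun p : Space => R • p + R • vertical := by fun_prop
    exact this.add ((hfp.comp this).smul contDiff_const)
  · intro p
    simp only [S, proj_add_smul_vertical]
    simp [hR.ne']
  · intro p
    simp only [smul_inv_smul₀ hR.ne', sub_add_cancel]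
    have : proj (S p) = proj p := by
      rw [← proj_add_smul_vertical (S p) (f (proj p))]
      simp [S]
    rw [this]
    simp [S]
  · intro p hp
    have h3 := norm_sub_smul_vertical_sq (S p) R
    have : ‖S p - R • vertical‖ < R := by
      refine lt_of_pow_lt_pow_left₀ 2 hR.le ?_
      linarith [hR₁ p hp]
    rw [norm_smul, norm_inv, Real.norm_of_nonneg hR.le, inv_mul_lt_iff₀ hR]
    simpa using this
  · intro p hp
    have h3 := norm_sub_smul_vertical_sq (S p) R
    have hneg : S p 2 < 0 := by rw [hS2]; exact sub_neg.2 (hf₂ p hp)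
    have : R < ‖S p - R • vertical‖ := by
      refine lt_of_pow_lt_pow_left₀ 2 (norm_nonneg _) ?_
      nlinarith [sq_nonneg ‖S p‖, mul_pos hR (neg_pos.2 hneg)]
    rw [norm_smul, norm_inv, Real.norm_of_nonneg hR.le, lt_inv_mul_iff₀ hR]
    simpa using this

/-! ### Transfer along the isotopy, under points and arcs -/

namespace Link

/-- A link equivalent to one that a diffeomorphism of space moves off the unit sphere, with points
on both sides, is splittable. -/
theorem isSplittable_of_equivalent {L D : Link} (hLD : L.Equivalent D) {F G : Space → Space}
    (hF : ContDiff ℝ ∞ F) (hG : ContDiff ℝ ∞ G) (hFG : Function.LeftInverse F G)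
    (hGF : Function.LeftInverse G F) (hS : ∀ r ∈ D.carrier, ‖F r‖ ≠ 1) {p q : Space}
    (hp : p ∈ D.carrier) (hq : q ∈ D.carrier) (hFp : ‖F p‖ < 1) (hFq : 1 < ‖F q‖) :
    L.IsSplittable := by
  obtain ⟨H, hH, hdiff, -, himg⟩ := hLD
  obtain ⟨E, hE, hEH, hHE⟩ := hdiff 1 (by simp)
  have hH1 : ContDiff ℝ ∞ (H 1) := by
    have := hH.comp (s := univ) (f := fun x : Space => ((1 : ℝ), x)) (by fun_prop)
      (fun x _ => by simp)
    exact contDiffOn_univ.1 this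
  rw [← himg] at hp hq hS
  obtain ⟨p, hp, rfl⟩ := hp
  obtain ⟨q, hq, rfl⟩ := hq
  exact isSplittable_of_diffeo (F := F ∘ H 1) (G := E ∘ G) (hF.comp hH1) (hE.comp hG)
    (fun x => by simp [hHE (G x), hFG x]) (fun x => by simp [hGF (H 1 x), hEH x])
    (fun r hr => hS _ (mem_image_of_mem _ hr)) hp hq hFp hFq

variable {D : Link}

theorem curve_mem_carrier (D : Link) (i : Fin D.n) (t : ℝ) : D.curve i t ∈ D.carrier := ⟨i, t, rfl⟩

theorem isCompact_iUnion_range (D : Link) (I : Set (Fin D.n)) :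
    IsCompact (⋃ i ∈ I, range (D.curve i)) := by
  refine I.toFinite.isCompact_biUnion fun i _ => ?_
  rw [← (D.periodic i).image_Icc one_pos 0]
  exact isCompact_Icc.image (D.smooth i).continuous

theorem not_mem_cut_iff {q : Space} (hq : q ∈ D.carrier) : q ∉ D.cut ↔ ∃ p, D.IsCrossing p q := by
  simp [cut, hq]

/-- The over point of a crossing is not an under point. -/
theorem IsCrossing.over_mem_cut (hD : D.IsRegular) {p q : Space} (h : D.IsCrossing p q) :
    p ∈ D.cut := by
  refine ⟨h.1, fun r hr => ?_⟩
  have h1 := hr.2.2.2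
  have h2 := h.2.2.2
  rcases hD.double r hr.1 p h.1 q h.2.1 hr.2.2.1 h.2.2.1 with rfl | rfl | rfl <;> linarith

/-- `proj` is injective on under points: a second under point with the same shadow would, for lack
of triple points, be the over point of the first. -/
theorem finite_under_points (hD : D.IsRegular) : (D.carrier \ D.cut).Finite := by
  refine Set.Finite.of_finite_image (f := proj) (hD.finite.subset ?_) ?_
  · rintro _ ⟨q, ⟨hq, hqc⟩, rfl⟩
    obtain ⟨p, hp⟩ := (not_mem_cut_iff hq).1 hqc
    exact ⟨p, hp.1, q, hq, by rintro rfl; exact lt_irrefl _ hp.2.2.2, hp.2.2.1, rfl⟩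
  · rintro q ⟨hq, hqc⟩ r ⟨hr, hrc⟩ hqr
    obtain ⟨p, hp⟩ := (not_mem_cut_iff hq).1 hqc
    rcases hD.double p hp.1 q hq r hr hp.2.2.1 hqr with rfl | h | rfl
    · exact absurd hp.2.2.2 (lt_irrefl _)
    · exact h
    · exact absurd (hp.over_mem_cut hD) hrc

/-- The times at which a component passes through under points are isolated. -/
theorem eventually_mem_cut (hD : D.IsRegular) (i : Fin D.n) (t : ℝ) :
    ∀ᶠ s in 𝓝[≠] t, D.curve i s ∈ D.cut := by
  have hclosed : IsClosed ((D.carrier \ D.cut) \ {D.curve i t}) :=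
    ((finite_under_points hD).subset sdiff_subset).isClosed
  have h1 : ∀ᶠ s in 𝓝[≠] t, D.curve i s ∉ (D.carrier \ D.cut) \ {D.curve i t} :=
    ((D.smooth i).continuous.continuousAt.eventually
      (hclosed.isOpen_compl.mem_nhds (by simp))).filter_mono nhdsWithin_le_nhds
  -- Within less than one period of `t`, the curve does not return to `D.curve i t`.
  have h2 : ∀ᶠ s in 𝓝[≠] t, s ∈ Ioo (t - 1) (t + 1) :=
    nhdsWithin_le_nhds (Ioo_mem_nhds (by linarith) (by linarith))
  filter_upwards [h1, h2, self_mem_nhdsWithin] with s hs hs' hne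
  by_contra hcut
  refine hs ⟨⟨D.curve_mem_carrier i s, hcut⟩, fun heq => ?_⟩
  obtain ⟨-, k, hk⟩ := D.embedded i i s t heq
  have hlt : (-1 : ℝ) < k := by linarith [hs'.1]
  have hgt : (k : ℝ) < 1 := by linarith [hs'.2]
  have : k = 0 := by
    have h1 : (-1 : ℤ) < k := by exact_mod_cast hlt
    have h2 : k < (1 : ℤ) := by exact_mod_cast hgt
    omega
  subst this
  exact hne (by simpa [sub_eq_zero] using hk)

/-- The arc through a point of the cut link. -/
def arcAt {q : Space} (hq : q ∈ D.cut) : D.Arc := ⟨connectedComponentIn D.cut q, q, hq, rfl⟩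

theorem mem_arcAt {q : Space} (hq : q ∈ D.cut) : q ∈ (arcAt hq).1 := mem_connectedComponentIn hq

theorem Arc.eq_arcAt (A : D.Arc) {q : Space} (hA : q ∈ A.1) (hq : q ∈ D.cut) : A = arcAt hq := by
  obtain ⟨A, x, hx, rfl⟩ := A
  exact Subtype.ext (connectedComponentIn_eq hA)

/-- A point of the cut link lies on an arc of colour `x`. -/
def HasColor (D : Link) (γ : D.Arc → ℤ) (x : ℤ) (q : Space) : Prop :=
  ∃ h : q ∈ D.cut, γ (arcAt h) = x

/-- Along a stretch of the link without under points one stays in the same arc. -/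
theorem mem_arcAt_of_forall_mem_cut {i : Fin D.n} {s : Set ℝ} (hs : s.OrdConnected)
    (h : ∀ u ∈ s, D.curve i u ∈ D.cut) {u v : ℝ} (hu : u ∈ s) (hv : v ∈ s) :
    D.curve i v ∈ (arcAt (h u hu)).1 :=
  (hs.isPreconnected.image _ (D.smooth i).continuous.continuousOn).subset_connectedComponentIn
    (mem_image_of_mem _ hu) (image_subset_iff.2 fun _ => h _) (mem_image_of_mem _ hv)

/-- Right before and right after any time, a component stays in one arc each; at a
point of the cut link, both are the arc through that point. -/
theorem exists_arcs (hD : D.IsRegular) (i : Fin D.n) (t : ℝ) : ∃ b c : D.Arc,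
    (∀ᶠ s in 𝓝[>] t, D.curve i s ∈ D.cut ∧ D.curve i s ∈ b.1) ∧
    (∀ᶠ s in 𝓝[<] t, D.curve i s ∈ D.cut ∧ D.curve i s ∈ c.1) ∧
    ∀ h : D.curve i t ∈ D.cut, b = arcAt h ∧ c = arcAt h := by
  obtain ⟨l, u, htlu, hlu⟩ := mem_nhds_iff_exists_Ioo_subset.1
    (eventually_nhdsWithin_iff.1 (eventually_mem_cut hD i t))
  have hcut : ∀ s ∈ Ioo l u, s ≠ t → D.curve i s ∈ D.cut := fun s hs hst => hlu hs hst
  have hr : ∀ s ∈ Ioo t u, D.curve i s ∈ D.cut := fun s hs =>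
    hcut s ⟨htlu.1.trans hs.1, hs.2⟩ hs.1.ne'
  have hl : ∀ s ∈ Ioo l t, D.curve i s ∈ D.cut := fun s hs =>
    hcut s ⟨hs.1, hs.2.trans htlu.2⟩ hs.2.ne
  obtain ⟨v, hv⟩ := exists_between htlu.2
  obtain ⟨w, hw⟩ := exists_between htlu.1
  refine ⟨arcAt (hr v hv), arcAt (hl w hw), ?_, ?_, fun h => ?_⟩
  · filter_upwards [Ioo_mem_nhdsGT htlu.2] with s hs
    exact ⟨hr s hs, mem_arcAt_of_forall_mem_cut ordConnected_Ioo hr hv hs⟩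
  · filter_upwards [Ioo_mem_nhdsLT htlu.1] with s hs
    exact ⟨hl s hs, mem_arcAt_of_forall_mem_cut ordConnected_Ioo hl hw hs⟩
  · have hall : ∀ s ∈ Ioo l u, D.curve i s ∈ D.cut := fun s hs => by
      rcases eq_or_ne s t with rfl | hne
      exacts [h, hcut s hs hne]
    exact ⟨Arc.eq_arcAt _ (mem_arcAt_of_forall_mem_cut ordConnected_Ioo hall
        ⟨htlu.1.trans hv.1, hv.2⟩ htlu) h, Arc.eq_arcAt _ (mem_arcAt_of_forall_mem_cut
        ordConnected_Ioo hall ⟨hw.1, hw.2.trans htlu.2⟩ htlu) h⟩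

/-! ### Propagation of the isolated color -/

/-- The colouring rule at an under point. -/
theorem IsZColoring.two_mul_eq (hD : D.IsRegular) {γ : D.Arc → ℤ} (hγ : D.IsZColoring γ)
    {i : Fin D.n} {t : ℝ} {p : Space} (hp : D.IsCrossing p (D.curve i t)) {b c : D.Arc}
    (hb : ∀ᶠ s in 𝓝[>] t, D.curve i s ∈ D.cut ∧ D.curve i s ∈ b.1)
    (hc : ∀ᶠ s in 𝓝[<] t, D.curve i s ∈ D.cut ∧ D.curve i s ∈ c.1) :
    2 * γ (arcAt (hp.over_mem_cut hD)) = γ b + γ c := by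
  refine hγ p i t hp _ b c (mem_arcAt _) ?_ ?_
  · have : Tendsto (fun ε => t + ε) (𝓝[>] (0 : ℝ)) (𝓝[>] t) := by
      refine tendsto_nhdsWithin_iff.2 ⟨?_, ?_⟩
      · exact ((continuous_const.add continuous_id).tendsto' 0 t (by simp)).mono_left
          nhdsWithin_le_nhds
      · filter_upwards [self_mem_nhdsWithin] with ε hε
        simpa using hε
    exact (this.eventually hb).mono fun _ h => h.2
  · have : Tendsto (fun ε => t - ε) (𝓝[>] (0 : ℝ)) (𝓝[<] t) := by
      refine tendsto_nhdsWithin_iff.2 ⟨?_, ?_⟩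
      · exact ((continuous_const.sub continuous_id).tendsto' 0 t (by simp)).mono_left
          nhdsWithin_le_nhds
      · filter_upwards [self_mem_nhdsWithin] with ε hε
        simpa using hε
    exact (this.eventually hc).mono fun _ h => h.2

/-- If the colour `x` is isolated in the sense of `exists_isolated_color`, each component is either
entirely of colour `x` or avoids it. -/
theorem component_dichotomy (hD : D.IsRegular) {γ : D.Arc → ℤ} (hγ : D.IsZColoring γ) {x : ℤ}
    (hx : ∀ a ∈ range γ, ∀ b ∈ range γ, ∀ c ∈ range γ, 2 * a = b + c → b = x → a = x ∧ c = x)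
    (i : Fin D.n) :
    (∀ t, ∀ᶠ s in 𝓝[≠] t, D.HasColor γ x (D.curve i s)) ∨
      ∀ t, ∀ᶠ s in 𝓝[≠] t, ¬ D.HasColor γ x (D.curve i s) := by
  have hcover : ∀ t, (∀ᶠ s in 𝓝[≠] t, D.HasColor γ x (D.curve i s)) ∨
      ∀ᶠ s in 𝓝[≠] t, ¬ D.HasColor γ x (D.curve i s) := by
    intro t
    obtain ⟨b, c, hb, hc, hbc⟩ := exists_arcs hD i t
    -- Isolation of `x` carries the color across an under point, in both directions.
    have hiff : γ b = x ↔ γ c = x := by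
      by_cases ht : D.curve i t ∈ D.cut
      · rw [(hbc ht).1, (hbc ht).2]
      · obtain ⟨p, hp⟩ := (not_mem_cut_iff (D.curve_mem_carrier i t)).1 ht
        have h2 := hγ.two_mul_eq hD hp hb hc
        exact ⟨fun h => (hx _ ⟨_, rfl⟩ _ ⟨_, rfl⟩ _ ⟨_, rfl⟩ h2 h).2,
          fun h => (hx _ ⟨_, rfl⟩ _ ⟨_, rfl⟩ _ ⟨_, rfl⟩ (h2.trans (add_comm _ _)) h).2⟩
    have hcol : ∀ {A : D.Arc} {q : Space}, q ∈ D.cut ∧ q ∈ A.1 → (D.HasColor γ x q ↔ γ A = x) := by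
      rintro A q ⟨hq, hA⟩
      rw [A.eq_arcAt hA hq]
      exact ⟨fun h => h.2, fun h => ⟨hq, h⟩⟩
    simp only [← Iio_union_Ioi (a := t), nhdsWithin_union, eventually_sup]
    by_cases h : γ b = x
    · exact Or.inl ⟨hc.mono fun s hs => (hcol hs).2 (hiff.1 h), hb.mono fun s hs => (hcol hs).2 h⟩
    · exact Or.inr ⟨hc.mono fun s hs h' => h (hiff.2 ((hcol hs).1 h')),
        hb.mono fun s hs h' => h ((hcol hs).1 h')⟩
  have hopen : ∀ P : ℝ → Prop, IsOpen {t | ∀ᶠ s in 𝓝[≠] t, P s} := by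
    intro P
    refine isOpen_iff_mem_nhds.2 fun t ht => ?_
    have h1 := eventually_nhdsNE_eventually_nhds_iff.2 ht
    rw [eventually_nhdsWithin_iff] at h1
    filter_upwards [h1] with s hs
    rcases eq_or_ne s t with rfl | hne
    · exact ht
    · exact (hs hne).filter_mono nhdsWithin_le_nhds
  -- Punctured neighborhoods ignore the under point itself, so both alternatives are open conditions
  -- on `t`; they are complementary, and `ℝ` is connected.
  have hclopen : IsClopen {t | ∀ᶠ s in 𝓝[≠] t, D.HasColor γ x (D.curve i s)} := by
    refine ⟨⟨?_⟩, hopen _⟩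
    convert hopen fun s => ¬ D.HasColor γ x (D.curve i s) using 1
    ext t
    refine ⟨(hcover t).resolve_left, fun h h' => ?_⟩
    obtain ⟨s, hs, hs'⟩ := ((show ∀ᶠ s in 𝓝[≠] t, _ from h).and h').exists
    exact absurd hs' hs
  rcases isClopen_iff.1 hclopen with h | h
  · exact Or.inr fun t => (hcover t).resolve_left (Set.eq_empty_iff_forall_notMem.1 h t)
  · exact Or.inl (Set.eq_univ_iff_forall.1 h)

/-- The colour of a point of the cut link is the colour of close-by points. -/
theorem eventually_hasColor_iff (hD : D.IsRegular) (γ : D.Arc → ℤ) (x : ℤ) {i : Fin D.n} {t : ℝ}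
    (ht : D.curve i t ∈ D.cut) :
    ∀ᶠ s in 𝓝[>] t, D.HasColor γ x (D.curve i s) ↔ D.HasColor γ x (D.curve i t) := by
  obtain ⟨b, c, hb, hc, hbc⟩ := exists_arcs hD i t
  filter_upwards [hb] with s hs
  have h1 : arcAt hs.1 = arcAt ht := (b.eq_arcAt hs.2 hs.1).symm.trans (hbc ht).1
  simp [HasColor, hs.1, ht, h1]

/-- In a regular diagram with a non-trivial colouring by at most three colours, some proper
sublink lies above the remaining components. -/
theorem exists_upper_sublink (hD : D.IsRegular) {γ : D.Arc → ℤ} (hγ : D.IsZColoring γ)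
    (hne : ∃ a b, γ a ≠ γ b) (hcard : (range γ).encard < 4) :
    ∃ I : Set (Fin D.n), I.Nonempty ∧ Iᶜ.Nonempty ∧
      ∀ p ∈ ⋃ i ∈ I, range (D.curve i), ∀ q ∈ ⋃ i ∈ Iᶜ, range (D.curve i),
        proj p = proj q → q 2 < p 2 := by
  obtain ⟨a₀, b₀, hab⟩ := hne
  obtain ⟨x, ⟨A, hA⟩, ⟨_, ⟨B, rfl⟩, hB⟩, hx⟩ :=
    exists_isolated_color hcard ⟨_, ⟨a₀, rfl⟩, _, ⟨b₀, rfl⟩, hab⟩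
  have hdich := component_dichotomy hD hγ hx
  let I : Set (Fin D.n) := {i | ∀ t, ∀ᶠ s in 𝓝[≠] t, D.HasColor γ x (D.curve i s)}
  have hI : ∀ i t, D.curve i t ∈ D.cut → (i ∈ I ↔ D.HasColor γ x (D.curve i t)) := by
    intro i t ht
    have h1 := eventually_hasColor_iff hD γ x ht
    have hle : 𝓝[>] t ≤ 𝓝[≠] t := nhdsWithin_mono _ fun s hs => ne_of_gt hs
    constructor
    · intro hi
      obtain ⟨s, hs, hs'⟩ := (h1.and ((hi t).filter_mono hle)).exists
      exact hs.1 hs'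
    · intro h
      refine (hdich i).resolve_right fun hi => ?_
      obtain ⟨s, hs, hs'⟩ := (h1.and ((hi t).filter_mono hle)).exists
      exact hs' (hs.2 h)
  have harc : ∀ C : D.Arc, ∃ i, i ∈ I ↔ γ C = x := by
    rintro ⟨C, y, hy, rfl⟩
    obtain ⟨i, t, rfl⟩ := hy.1
    exact ⟨i, (hI i t hy).trans ⟨fun h => h.2, fun h => ⟨hy, h⟩⟩⟩
  refine ⟨I, ?_, ?_, ?_⟩
  · obtain ⟨i, hi⟩ := harc A
    exact ⟨i, hi.2 hA⟩
  · obtain ⟨i, hi⟩ := harc B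
    exact ⟨i, fun h => hB (hi.1 h)⟩
  · intro p hp q hq hpq
    simp only [mem_iUnion₂, mem_range] at hp hq
    obtain ⟨i, hi, s, rfl⟩ := hp
    obtain ⟨j, hj, t, rfl⟩ := hq
    by_contra! hle
    rcases hle.lt_or_eq with hlt | heq
    -- If a component in `I` passed under one outside `I`, the under arc of color `x` would force
    -- `x` on the over arc.
    · have hcr : D.IsCrossing (D.curve j t) (D.curve i s) :=
        ⟨D.curve_mem_carrier j t, D.curve_mem_carrier i s, hpq.symm, hlt⟩
      obtain ⟨b, c, hb, hc, -⟩ := exists_arcs hD i s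
      have hbx : γ b = x := by
        have hle : 𝓝[>] s ≤ 𝓝[≠] s := nhdsWithin_mono _ fun s hs => ne_of_gt hs
        obtain ⟨u, hu, hcut, hux⟩ := (hb.and ((hi s).filter_mono hle)).exists
        rwa [b.eq_arcAt hu.2 hcut]
      have := (hx _ ⟨_, rfl⟩ _ ⟨_, rfl⟩ _ ⟨_, rfl⟩ (hγ.two_mul_eq hD hcr hb hc) hbx).1
      exact hj ((hI j t (hcr.over_mem_cut hD)).2 ⟨_, this⟩)
    -- At equal heights the points coincide, so disjointness of the components gives `i = j`.
    · have hpt : D.curve i s = D.curve j t := by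
        ext k
        have h0 := congrArg (fun v : Plane => v 0) hpq
        have h1 := congrArg (fun v : Plane => v 1) hpq
        simp [proj] at h0 h1
        fin_cases k
        exacts [h0, h1, heq]
      obtain ⟨rfl, -⟩ := D.embedded i j s t hpt
      exact hj hi

end Link

theorem theorem3p1 (L : Link) (hns : ¬ L.IsSplittable) (hcol : L.IsZColorable) :
    4 ≤ L.mincolZ := by
  refine le_sInf ?_
  rintro _ ⟨D, γ, ⟨hLD, hD, hγ, hne⟩, rfl⟩
  by_contra! hcard
  refine hns ?_
  obtain ⟨I, ⟨i, hi⟩, ⟨j, hj⟩, habove⟩ := Link.exists_upper_sublink hD hγ hne hcard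
  obtain ⟨F, G, hF, hG, hFG, hGF, h₁, h₂⟩ := exists_diffeo_separating
    (D.isCompact_iUnion_range I) (D.isCompact_iUnion_range Iᶜ) habove
  have hI : ∀ k t, k ∈ I → ‖F (D.curve k t)‖ < 1 := fun k t hk => h₁ _ (by
    simp only [mem_iUnion₂]; exact ⟨k, hk, t, rfl⟩)
  have hIc : ∀ k t, k ∉ I → 1 < ‖F (D.curve k t)‖ := fun k t hk => h₂ _ (by
    simp only [mem_iUnion₂]; exact ⟨k, hk, t, rfl⟩)
  refine Link.isSplittable_of_equivalent hLD hF hG hFG hGF ?_ (D.curve_mem_carrier i 0)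
    (D.curve_mem_carrier j 0) (hI i 0 hi) (hIc j 0 hj)
  rintro _ ⟨k, t, rfl⟩
  by_cases hk : k ∈ I
  exacts [(hI k t hk).ne, (hIc k t hk).ne']
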